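/- Setting. There are $k\ge 1$ crowds and $n\ge 2$ options. A problem instance consists of probability distributions $D_1,\dots,D_k$ on the set of options such that one option $x^*$ is the unique most probable option of every $D_i$. In each round an algorithm chooses a crowd $i$, possibly at random and depending on all earlier choices and answers, and receives an independent sample from $D_i$; the instance is unknown to the algorithm. Costs are uniform: each round costs the same amount, normalized to $1$, so that the total cost is the number of rounds until stopping. The gap of a distribution $D$ on the options is its largest value minus its second-largest value (counted with multiplicity). For a distribution $\mu$ over crowds, the induced gap $f(\mu)$ is the gap of the mixture $\sum_i \mu_i D_i$, and $f^*=\max_\mu f(\mu)$. For $C>0$ and an integer $T\ge 2$, let $R_0$ be the stopping rule that, applied to a stream of answers, stops after $t\ge 1$ answers if and only if the gap of their empirical distribution exceeds $C/\sqrt t$ or $t=T$. The composite stopping rule runs one instance of $R_0$ on the stream of all answers (the total crowd) and, for each crowd, one instance on the answers of this crowd, and it stops as soon as some instance stops. Let $\mathrm{cost}(A|R_0)$ be the expected total cost of a crowd-selection algorithm $A$ run with the composite stopping rule. Theorem. For all $k\ge 1$, $n\ge 2$ and $C>0$ there is a constant $K$, depending only on $k$, $n$ and $C$, such that for every $T\ge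 2$ there is a crowd-selection algorithm $A$ for which, on every problem instance, $$\mathrm{cost}(A|R_0)\;\le\; K\,(f^*)^{-(k+2)}\,\sqrt{\log T}.$$ The same bound holds, for the same $A$, if only the instance of $R_0$ on the total crowd is used for stopping. -/

import Mathlib

open scoped NNReal ENNReal

namespace BanditSurvey

/-- The largest value of `p`. -/
noncomputable def largest {n : ℕ} (p : Fin n → ℝ) : ℝ := ⨆ x, p x

/-- The second-largest value of `p`, counted with multiplicity: the best that the smaller
of the values at two distinct options can be. -/
noncomputable def secondLargest {n : ℕ} (p : Fin n → ℝ) : ℝ :=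
  ⨆ q : {q : Fin n × Fin n // q.1 ≠ q.2}, min (p q.1.1) (p q.1.2)

/-- The gap: the largest value minus the second-largest value. -/
noncomputable def gap {n : ℕ} (p : Fin n → ℝ) : ℝ := largest p - secondLargest p

/-- The empirical distribution of a sequence of observed options. -/
noncomputable def empirical {n : ℕ} (s : List (Fin n)) : Fin n → ℝ :=
  fun x => (s.count x : ℝ) / s.length

/-- `k` crowds with response distributions `D i` on `n` options; all crowds agree on the
correct answer: one option is the unique most probable option of every crowd. -/
structure Instance (k n : ℕ) where
  D : Fin k → PMF (Fin n)
  answer : Fin n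
  unique_top : ∀ i x, x ≠ answer → D i x < D i answer

/-- The induced gap `f(μ)` of a distribution `μ` over crowds: the gap of the mixture
`D_μ(x) = E_{i ∼ μ} [D_i(x)]`. -/
noncomputable def inducedGap {k n : ℕ} (I : Instance k n) (μ : PMF (Fin k)) : ℝ :=
  gap fun x => ((μ.bind I.D) x).toReal

/-- The maximal induced gap `f*`. -/
noncomputable def maxInducedGap {k n : ℕ} (I : Instance k n) : ℝ :=
  ⨆ μ : PMF (Fin k), inducedGap I μ

/-- What has been observed so far, the most recent round first: in each round, the crowd that
was asked and the option it answered. -/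
abbrev History (k n : ℕ) := List (Fin k × Fin n)

/-- A (randomized, adaptive) crowd-selection algorithm: given the history, the distribution
from which the crowd of the next round is drawn. -/
abbrev CrowdSelection (k n : ℕ) := History k n → PMF (Fin k)

/-- A deterministic single-crowd stopping rule: whether to stop once the given observations (most
recent first) have been received. -/
abbrev StoppingRule (n : ℕ) := List (Fin n) → Prop

/-- The rule with quality parameter `C` and horizon `T`: stop after `t ≥ 1` observations
iff the empirical gap exceeds `C / √t` or `t = T`. -/
def gapRule (n : ℕ) (C : ℝ) (T : ℕ) : StoppingRule n := fun s =>
  0 < s.length ∧ (C / √(s.length : ℝ) < gap (empirical s) ∨ s.length = T)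

/-- The answers of all crowds together (the total crowd). -/
def totalAnswers {k n : ℕ} (h : History k n) : List (Fin n) := h.map Prod.snd

/-- The answers of crowd `i`. -/
def crowdAnswers {k n : ℕ} (h : History k n) (i : Fin k) : List (Fin n) :=
  (h.filter fun e => e.1 = i).map Prod.snd

/-- The instance of `R₀` for the total crowd, on its own. -/
def totalRule {k n : ℕ} (R₀ : StoppingRule n) : History k n → Prop :=
  fun h => R₀ (totalAnswers h)

/-- The composite stopping rule based on `R₀`: one instance of `R₀` for the total crowd and one
for each crowd; stop as soon as some instance stops. -/
def compositeRule {k n : ℕ} (R₀ : StoppingRule n) : History k n → Prop :=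
  fun h => R₀ (totalAnswers h) ∨ ∃ i, R₀ (crowdAnswers h i)

open Classical in
/-- The law of the history after at most `t` rounds of running `A` with the stopping rule `rule`:
in each round before stopping, a crowd is drawn from the distribution chosen by `A`, and an answer
is drawn from the response distribution of this crowd. -/
noncomputable def run {k n : ℕ} (I : Instance k n) (A : CrowdSelection k n)
    (rule : History k n → Prop) : ℕ → PMF (History k n)
  | 0 => PMF.pure []
  | t + 1 => (run I A rule t).bind fun h =>
      if rule h then PMF.pure h
      else (A h).bind fun i => (I.D i).bind fun x => PMF.pure ((i, x) :: h)

/-- The total cost of the rounds in a history, for the cost vector `c`. -/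
def totalCost {k n : ℕ} (c : Fin k → ℝ≥0) (h : History k n) : ℝ≥0 :=
  (h.map fun e => c e.1).sum

/-- The expected total cost until stopping: the (increasing) limit over `t` of the expected total
cost of the first `t` rounds. -/
noncomputable def expectedCost {k n : ℕ} (I : Instance k n) (c : Fin k → ℝ≥0)
    (A : CrowdSelection k n) (rule : History k n → Prop) : ℝ≥0∞ :=
  ⨆ t : ℕ, ∑' h : History k n, run I A rule t h * (totalCost c h : ℝ≥0∞)

/-- `cost(A | R₀)`: the expected total cost of `A` run together with the composite stopping rule
based on `R₀`. -/
noncomputable def cost {k n : ℕ} (I : Instance k n) (c : Fin k → ℝ≥0)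
    (A : CrowdSelection k n) (R₀ : StoppingRule n) : ℝ≥0∞ :=
  expectedCost I c A (compositeRule R₀)

end BanditSurvey

namespace BanditSurvey

/-! ### Gaps -/

/-! The non-adaptive algorithm that always draws a uniform crowd suffices. All crowds have the same
top option, so their margins cannot cancel in a mixture, and the uniform mixture has gap g ≥ f*/k
(`inducedGap_le_mul_uniform`).

Under this algorithm the answers are independent samples from one distribution with gap g. If the
total crowd has not stopped after t answers, some wrong option trails the correct one by at most
C√t, whereas the expected lead is at least gt. A Chernoff bound and a union bound over the wrong
options make this exponentially unlikely once t exceeds order 1/g² (`tsum_run_active_exp_lead_le`,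
`probActive_le`). Summing over t gives expected cost O(1/g²), uniformly in T. This is stronger than
the claim, since f* ≤ 1 and log T ≥ log 2. -/

theorem exists_sub_le_gap {n : ℕ} (hn : 2 ≤ n) (p : Fin n → ℝ) (a : Fin n) :
    ∃ x, x ≠ a ∧ p a - p x ≤ gap p := by
  have : Nontrivial (Fin n) := Fin.nontrivial_iff_two_le.2 hn
  obtain ⟨u, v, huv⟩ := exists_pair_ne (Fin n)
  have : Nonempty {q : Fin n × Fin n // q.1 ≠ q.2} := ⟨⟨(u, v), huv⟩⟩
  obtain ⟨⟨⟨x, y⟩, hxy⟩, h⟩ := exists_eq_ciSup_of_finite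
    (f := fun q : {q : Fin n × Fin n // q.1 ≠ q.2} => min (p q.1.1) (p q.1.2))
  have hl : p a ≤ largest p := le_ciSup (Set.finite_range p).bddAbove a
  have hs : secondLargest p = min (p x) (p y) := h.symm
  -- The pair attaining the second-largest value has distinct entries, so one of them differs from
  -- `a`.
  by_cases hx : x = a
  · refine ⟨y, fun hy => hxy (hx.trans hy.symm), ?_⟩
    have := min_le_right (p x) (p y)
    unfold gap
    linarith
  · refine ⟨x, hx, ?_⟩
    have := min_le_left (p x) (p y)
    unfold gap
    linarith

theorem gap_le_sub {n : ℕ} {p : Fin n → ℝ} {a x : Fin n} (ha : ∀ y, p y ≤ p a) (hx : x ≠ a) :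
    gap p ≤ p a - p x := by
  have : Nonempty (Fin n) := ⟨a⟩
  have hl : largest p ≤ p a := ciSup_le ha
  have hs : min (p x) (p a) ≤ secondLargest p :=
    le_ciSup (f := fun q : {q : Fin n × Fin n // q.1 ≠ q.2} => min (p q.1.1) (p q.1.2))
      (Set.finite_range _).bddAbove ⟨(x, a), hx⟩
  rw [min_eq_left (ha x)] at hs
  unfold gap
  linarith

/-! ### Mixtures of crowds -/

theorem toReal_bind_apply {k n : ℕ} (D : Fin k → PMF (Fin n)) (μ : PMF (Fin k)) (x : Fin n) :
    ((μ.bind D) x).toReal = ∑ i, (μ i).toReal * (D i x).toReal := by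
  rw [PMF.bind_apply, tsum_fintype, ENNReal.toReal_sum
    fun i _ => ENNReal.mul_ne_top (μ.apply_ne_top i) ((D i).apply_ne_top x)]
  simp

theorem Instance.toReal_le {k n : ℕ} (I : Instance k n) (i : Fin k) (x : Fin n) :
    (I.D i x).toReal ≤ (I.D i I.answer).toReal := by
  refine ENNReal.toReal_mono ((I.D i).apply_ne_top _) ?_
  by_cases h : x = I.answer
  · rw [h]
  · exact (I.unique_top i x h).le

theorem Instance.mixture_le {k n : ℕ} (I : Instance k n) (μ : PMF (Fin k)) (x : Fin n) :
    ((μ.bind I.D) x).toReal ≤ ((μ.bind I.D) I.answer).toReal := by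
  simp only [toReal_bind_apply]
  exact Finset.sum_le_sum fun i _ => mul_le_mul_of_nonneg_left (I.toReal_le i x)
    ENNReal.toReal_nonneg

theorem toReal_apply_le_one {α : Type*} (p : PMF α) (x : α) : (p x).toReal ≤ 1 :=
  ENNReal.toReal_le_of_le_ofReal zero_le_one (by simpa using p.coe_le_one x)

theorem inducedGap_le_sub {k n : ℕ} (I : Instance k n) (μ : PMF (Fin k)) {x : Fin n}
    (hx : x ≠ I.answer) :
    inducedGap I μ ≤ ((μ.bind I.D) I.answer).toReal - ((μ.bind I.D) x).toReal :=
  gap_le_sub (p := fun x => ((μ.bind I.D) x).toReal) (I.mixture_le μ) hx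

theorem inducedGap_le_one {k n : ℕ} (hn : 2 ≤ n) (I : Instance k n) (μ : PMF (Fin k)) :
    inducedGap I μ ≤ 1 := by
  have : Nontrivial (Fin n) := Fin.nontrivial_iff_two_le.2 hn
  obtain ⟨x, hx⟩ := exists_ne I.answer
  have h₁ := inducedGap_le_sub I μ hx
  have h₂ := toReal_apply_le_one (μ.bind I.D) I.answer
  have h₃ : 0 ≤ ((μ.bind I.D) x).toReal := ENNReal.toReal_nonneg
  linarith

theorem toReal_uniformOfFintype {k : ℕ} [Nonempty (Fin k)] (i : Fin k) :
    (PMF.uniformOfFintype (Fin k) i).toReal = (k : ℝ)⁻¹ := by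
  simp [PMF.uniformOfFintype_apply]

/-- Since all crowds agree on the answer, the uniform mixture has at least a `1 / k` fraction of
the induced gap of any other mixture. -/
theorem inducedGap_le_mul_uniform {k n : ℕ} [Nonempty (Fin k)] (hn : 2 ≤ n) (I : Instance k n)
    (μ : PMF (Fin k)) :
    inducedGap I μ ≤ k * inducedGap I (PMF.uniformOfFintype (Fin k)) := by
  have hk : (0 : ℝ) < k := by exact_mod_cast Fin.pos (Classical.arbitrary (Fin k))
  obtain ⟨x, hx, h⟩ := exists_sub_le_gap hn
    (fun x => (((PMF.uniformOfFintype (Fin k)).bind I.D) x).toReal) I.answer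
  have hμ := inducedGap_le_sub I μ hx
  simp only [toReal_bind_apply, toReal_uniformOfFintype, ← Finset.mul_sum, ← mul_sub,
    ← Finset.sum_sub_distrib] at h hμ
  rw [inv_mul_le_iff₀ hk] at h
  simp only [inducedGap, toReal_bind_apply, toReal_uniformOfFintype, ← Finset.mul_sum] at hμ ⊢
  refine hμ.trans (le_trans (Finset.sum_le_sum fun i _ => ?_) h)
  -- Every crowd's margin is nonnegative, so raising its weight from `μ i` to 1 only increases the
  -- sum.
  exact mul_le_of_le_one_left (sub_nonneg.2 (I.toReal_le i x)) (toReal_apply_le_one μ i)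

theorem inducedGap_uniform_pos {k n : ℕ} [Nonempty (Fin k)] (hn : 2 ≤ n) (I : Instance k n) :
    0 < inducedGap I (PMF.uniformOfFintype (Fin k)) := by
  have hk : (0 : ℝ) < k := by exact_mod_cast Fin.pos (Classical.arbitrary (Fin k))
  obtain ⟨x, hx, h⟩ := exists_sub_le_gap hn
    (fun x => (((PMF.uniformOfFintype (Fin k)).bind I.D) x).toReal) I.answer
  refine lt_of_lt_of_le (sub_pos.2 ?_) h
  simp only [toReal_bind_apply, toReal_uniformOfFintype]
  refine Finset.sum_lt_sum_of_nonempty Finset.univ_nonempty fun i _ => ?_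
  refine mul_lt_mul_of_pos_left ?_ (inv_pos.2 hk)
  exact ENNReal.toReal_strict_mono ((I.D i).apply_ne_top _) (I.unique_top i x hx)

theorem maxInducedGap_le_mul_uniform {k n : ℕ} [Nonempty (Fin k)] (hn : 2 ≤ n)
    (I : Instance k n) :
    maxInducedGap I ≤ k * inducedGap I (PMF.uniformOfFintype (Fin k)) :=
  have : Nonempty (PMF (Fin k)) := ⟨PMF.uniformOfFintype (Fin k)⟩
  ciSup_le (inducedGap_le_mul_uniform hn I)

theorem maxInducedGap_le_one {k n : ℕ} [Nonempty (Fin k)] (hn : 2 ≤ n) (I : Instance k n) :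
    maxInducedGap I ≤ 1 :=
  have : Nonempty (PMF (Fin k)) := ⟨PMF.uniformOfFintype (Fin k)⟩
  ciSup_le (inducedGap_le_one hn I)

theorem maxInducedGap_pos {k n : ℕ} [Nonempty (Fin k)] (hn : 2 ≤ n) (I : Instance k n) :
    0 < maxInducedGap I :=
  (inducedGap_uniform_pos hn I).trans_le
    (le_ciSup ⟨1, Set.forall_mem_range.2 (inducedGap_le_one hn I)⟩ _)

/-! ### Exponential moments -/

theorem tsum_bind_mul {α β : Type*} (p : PMF α) (f : α → PMF β) (w : β → ℝ≥0∞) :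
    ∑' b, (p.bind f) b * w b = ∑' a, p a * ∑' b, f a b * w b := by
  simp only [PMF.bind_apply, ← ENNReal.tsum_mul_right, ← ENNReal.tsum_mul_left]
  rw [ENNReal.tsum_comm]
  simp only [mul_assoc]

theorem tsum_pure_mul {α : Type*} (a : α) (w : α → ℝ≥0∞) :
    ∑' b, PMF.pure a b * w b = w a := by
  rw [tsum_eq_single a fun b hb => by simp [PMF.pure_apply, hb]]
  simp

/-- The contribution of one answer `y` to the lead of the option `a` over the option `x`. -/
noncomputable def leadIncrement {n : ℕ} (a x y : Fin n) : ℝ :=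
  (if y = a then 1 else 0) - (if y = x then 1 else 0)

/-- The lead of the option `a` over the option `x` in a sequence of answers. -/
noncomputable def lead {n : ℕ} (a x : Fin n) (s : List (Fin n)) : ℝ :=
  (s.count a : ℝ) - s.count x

theorem lead_cons {n : ℕ} (a x y : Fin n) (s : List (Fin n)) :
    lead a x (y :: s) = leadIncrement a x y + lead a x s := by
  simp only [lead, leadIncrement, List.count_cons, beq_iff_eq, Nat.cast_add, Nat.cast_ite,
    Nat.cast_one, Nat.cast_zero]
  ring

theorem exp_neg_mul_leadIncrement_le {n : ℕ} (a x y : Fin n) {r : ℝ} (h₀ : 0 ≤ r) (h₁ : r ≤ 1) :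
    Real.exp (-r * leadIncrement a x y) ≤ 1 - r * leadIncrement a x y + r ^ 2 := by
  have hY : |leadIncrement a x y| ≤ 1 := by
    unfold leadIncrement
    split_ifs <;> norm_num
  have hu : |-r * leadIncrement a x y| ≤ 1 := by
    rw [abs_mul, abs_neg, abs_of_nonneg h₀]
    exact mul_le_one₀ h₁ (abs_nonneg _) hY
  have h := (abs_le.1 (Real.abs_exp_sub_one_sub_id_le hu)).2
  have hY2 : leadIncrement a x y ^ 2 ≤ 1 := (sq_le_one_iff_abs_le_one _).2 hY
  nlinarith [mul_le_mul_of_nonneg_left hY2 (sq_nonneg r)]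

/-- The second-order bound on the exponential gives 1 - rg + r² at parameter r; the choice r = g/2
minimizes this, with value 1 - g²/4. -/
theorem tsum_exp_lead_le {n : ℕ} (q : PMF (Fin n)) {a x : Fin n} {g : ℝ} (h₀ : 0 ≤ g)
    (h₁ : g ≤ 1) (hg : g ≤ (q a).toReal - (q x).toReal) :
    ∑' y, q y * ENNReal.ofReal (Real.exp (-(g / 2) * leadIncrement a x y)) ≤
      ENNReal.ofReal (Real.exp (-(g ^ 2 / 4))) := by
  have hsum : ∑ y, (q y).toReal = 1 := by
    rw [← ENNReal.toReal_sum fun y _ => q.apply_ne_top y, ← tsum_fintype (L := .unconditional _),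
      q.tsum_coe, ENNReal.toReal_one]
  have hreal : ∑ y, (q y).toReal * Real.exp (-(g / 2) * leadIncrement a x y) ≤
      Real.exp (-(g ^ 2 / 4)) := by
    calc _ ≤ ∑ y, (q y).toReal * (1 - g / 2 * leadIncrement a x y + (g / 2) ^ 2) :=
          Finset.sum_le_sum fun y _ => mul_le_mul_of_nonneg_left
            (exp_neg_mul_leadIncrement_le a x y (by linarith) (by linarith)) ENNReal.toReal_nonneg
      _ = (1 + (g / 2) ^ 2) * ∑ y, (q y).toReal -
            g / 2 * ∑ y, (q y).toReal * leadIncrement a x y := by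
          rw [Finset.mul_sum, Finset.mul_sum, ← Finset.sum_sub_distrib]
          exact Finset.sum_congr rfl fun y _ => by ring
      _ = (1 + (g / 2) ^ 2) - g / 2 * ((q a).toReal - (q x).toReal) := by
          simp [hsum, leadIncrement, mul_sub, Finset.sum_sub_distrib]
      _ ≤ -(g ^ 2 / 4) + 1 := by nlinarith [mul_le_mul_of_nonneg_left hg h₀]
      _ ≤ _ := Real.add_one_le_exp _
  rw [tsum_fintype]
  refine le_trans (le_of_eq ?_) (ENNReal.ofReal_le_ofReal hreal)
  rw [ENNReal.ofReal_sum_of_nonneg fun y _ =>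
    mul_nonneg ENNReal.toReal_nonneg (Real.exp_pos _).le]
  refine Finset.sum_congr rfl fun y _ => ?_
  rw [ENNReal.ofReal_mul ENNReal.toReal_nonneg, ENNReal.ofReal_toReal (q.apply_ne_top y)]

/-! ### Runs -/

section Runs

variable {k n : ℕ} (I : Instance k n) (A : CrowdSelection k n) (rule : History k n → Prop)

open Classical in
theorem tsum_run_succ_mul (w : History k n → ℝ≥0∞) (t : ℕ) :
    ∑' h, run I A rule (t + 1) h * w h = ∑' h, run I A rule t h *
      (if rule h then w h else ∑' i, A h i * ∑' x, I.D i x * w ((i, x) :: h)) := by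
  rw [run, tsum_bind_mul]
  refine tsum_congr fun h => ?_
  congr 1
  split_ifs
  · exact tsum_pure_mul h w
  · simp only [tsum_bind_mul, tsum_pure_mul]

/-- A history stops growing only when the rule fires. Hence survival fixes the length, and the
threshold C/√t can be used with t the round number. -/
theorem rule_or_length_eq_of_mem_support (t : ℕ) (h : History k n)
    (hh : h ∈ (run I A rule t).support) : rule h ∨ h.length = t := by
  induction t generalizing h with
  | zero =>
    have : h = [] := by simpa [run] using hh
    simp [this]
  | succ t ih =>
    rw [run, PMF.mem_support_bind_iff] at hh
    obtain ⟨h', hm, hh⟩ := hh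
    split_ifs at hh with hr
    · have : h = h' := by simpa using hh
      exact Or.inl (this ▸ hr)
    · simp only [PMF.mem_support_bind_iff, PMF.support_pure, Set.mem_singleton_iff] at hh
      obtain ⟨i, -, x, -, rfl⟩ := hh
      exact Or.inr (by simpa using (ih h' hm).resolve_left hr)

open Classical in
/-- The probability that the run has not stopped after `t` rounds. -/
noncomputable def probActive (t : ℕ) : ℝ≥0∞ :=
  ∑' h, run I A rule t h * (if rule h then 0 else 1)

/-- Tail-sum formula: round s + 1 takes place exactly when the run is still active after s rounds.
-/
theorem tsum_run_mul_length (t : ℕ) :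
    ∑' h, run I A rule t h * (h.length : ℝ≥0∞) = ∑ s ∈ Finset.range t, probActive I A rule s := by
  classical
  induction t with
  | zero => simp [run]
  | succ t ih =>
    rw [tsum_run_succ_mul, Finset.sum_range_succ, ← ih, probActive, ← ENNReal.tsum_add]
    refine tsum_congr fun h => ?_
    rw [← mul_add]
    congr 1
    split_ifs
    · simp
    · simp only [List.length_cons, ENNReal.tsum_mul_right, PMF.tsum_coe, one_mul]
      push_cast
      rfl

theorem totalCost_const (c : ℝ≥0) (h : History k n) :
    totalCost (fun _ => c) h = c * h.length := by
  simp [totalCost, mul_comm]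

theorem expectedCost_const_le (c : ℝ≥0) :
    expectedCost I (fun _ => c) A rule ≤ c * ∑' s, probActive I A rule s := by
  refine iSup_le fun t => ?_
  have : ∑' h, run I A rule t h * (totalCost (fun _ => c) h : ℝ≥0∞) =
      c * ∑' h, run I A rule t h * (h.length : ℝ≥0∞) := by
    rw [← ENNReal.tsum_mul_left]
    refine tsum_congr fun h => ?_
    rw [totalCost_const]
    push_cast
    ring
  rw [this, tsum_run_mul_length]
  gcongr
  exact ENNReal.sum_le_tsum _

open Classical in
/-- With a fixed sampling distribution `μ`, the exponential moment of the negative lead of the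
answer, restricted to the runs that have not stopped, decays geometrically. -/
theorem tsum_run_active_exp_lead_le (μ : PMF (Fin k)) (hn : 2 ≤ n) (hμ : 0 ≤ inducedGap I μ)
    {x : Fin n} (hx : x ≠ I.answer) (t : ℕ) :
    ∑' h, run I (fun _ => μ) rule t h * (if rule h then 0 else ENNReal.ofReal
        (Real.exp (-(inducedGap I μ / 2) * lead I.answer x (totalAnswers h)))) ≤
      ENNReal.ofReal (Real.exp (-(inducedGap I μ ^ 2 / 4))) ^ t := by
  set g := inducedGap I μ
  set ρ := ENNReal.ofReal (Real.exp (-(g ^ 2 / 4)))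
  set w : History k n → ℝ≥0∞ := fun h =>
    ENNReal.ofReal (Real.exp (-(g / 2) * lead I.answer x (totalAnswers h))) with hw
  change ∑' h, run I (fun _ => μ) rule t h * (if rule h then 0 else w h) ≤ ρ ^ t
  induction t with
  | zero =>
    simp only [run, tsum_pure_mul, pow_zero]
    split_ifs
    · exact zero_le_one
    · simp [hw, lead, totalAnswers]
  | succ t ih =>
    -- The next answer is a fresh sample from the mixture, so one round multiplies the moment by at
    -- most `ρ`.
    have hstep : ∀ h : History k n, ∑' i, μ i * ∑' y, I.D i y * w ((i, y) :: h) ≤ ρ * w h := by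
      intro h
      have hcons : ∀ i y, w ((i, y) :: h) =
          ENNReal.ofReal (Real.exp (-(g / 2) * leadIncrement I.answer x y)) * w h := by
        intro i y
        have : totalAnswers ((i, y) :: h) = y :: totalAnswers h := rfl
        simp only [hw, this, lead_cons, mul_add, Real.exp_add]
        rw [ENNReal.ofReal_mul (Real.exp_pos _).le]
      simp only [hcons, ← mul_assoc, ENNReal.tsum_mul_right]
      simp only [← tsum_bind_mul]
      gcongr
      exact tsum_exp_lead_le _ hμ (inducedGap_le_one hn I μ) (inducedGap_le_sub I μ hx)
    rw [tsum_run_succ_mul, pow_succ']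
    refine le_trans ?_ (mul_le_mul_right ih ρ)
    rw [← ENNReal.tsum_mul_left]
    refine ENNReal.tsum_le_tsum fun h => ?_
    rw [mul_left_comm]
    gcongr
    split_ifs
    · simp
    -- Dropping the restriction to extended histories that are still active only increases the sum.
    · refine le_trans ?_ (hstep h)
      gcongr
      split_ifs <;> simp

end Runs

/-! ### The uniform algorithm -/

/-- Multiplying the empirical gap bound C/√t by t turns frequencies into counts. The empty sequence,
on which the rule never fires, has lead 0. -/
theorem exists_lead_le_of_not_gapRule {n : ℕ} (hn : 2 ≤ n) {C : ℝ} {T : ℕ}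
    (a : Fin n) {s : List (Fin n)} (hs : ¬ gapRule n C T s) :
    ∃ x, x ≠ a ∧ lead a x s ≤ C * √(s.length : ℝ) := by
  obtain ⟨x, hx, h⟩ := exists_sub_le_gap hn (empirical s) a
  refine ⟨x, hx, ?_⟩
  rcases Nat.eq_zero_or_pos s.length with h0 | h0
  · rw [List.length_eq_zero_iff] at h0
    simp [h0, lead]
  have hgap : gap (empirical s) ≤ C / √(s.length : ℝ) := by
    by_contra hlt
    exact hs ⟨h0, Or.inl (not_le.1 hlt)⟩
  have hlen : (0 : ℝ) < s.length := by exact_mod_cast h0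
  have := h.trans hgap
  rw [empirical, empirical, ← sub_div, div_le_iff₀ hlen] at this
  refine this.trans_eq ?_
  have hsq := Real.mul_self_sqrt hlen.le
  have hpos := Real.sqrt_pos.2 hlen
  rw [div_mul_eq_mul_div, div_eq_iff hpos.ne', mul_assoc, hsq]

/-- Markov's inequality for the exponential moment, with a union bound over the wrong options.
Assuming only that `rule` fires whenever the total crowd's rule does covers both stopping rules of
the theorem. -/
theorem probActive_le {k n : ℕ} (hn : 2 ≤ n) {C : ℝ} {T : ℕ} (I : Instance k n)
    (μ : PMF (Fin k)) (hμ : 0 ≤ inducedGap I μ) (rule : History k n → Prop)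
    (hrule : ∀ h, totalRule (gapRule n C T) h → rule h) (t : ℕ) :
    probActive I (fun _ => μ) rule t ≤
      ENNReal.ofReal (n * Real.exp (C ^ 2 / 2) * Real.exp (-(inducedGap I μ ^ 2 / 8)) ^ t) := by
  classical
  set g := inducedGap I μ with hg
  set b := ENNReal.ofReal (Real.exp (g / 2 * (C * √(t : ℝ)))) with hb
  set w : Fin n → History k n → ℝ≥0∞ := fun x h => if rule h then 0 else ENNReal.ofReal
    (Real.exp (-(g / 2) * lead I.answer x (totalAnswers h))) with hw
  set S := Finset.univ.filter fun x => x ≠ I.answer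
  have hpt : ∀ h, run I (fun _ => μ) rule t h * (if rule h then 0 else 1) ≤
      ∑ x ∈ S, b * (run I (fun _ => μ) rule t h * w x h) := by
    intro h
    by_cases hr : rule h
    · simp [hr]
    by_cases h0 : run I (fun _ => μ) rule t h = 0
    · simp [h0]
    have hlen : (totalAnswers h).length = t := by
      rw [totalAnswers, List.length_map]
      exact (rule_or_length_eq_of_mem_support I _ rule t h
        ((PMF.mem_support_iff _ _).2 h0)).resolve_left hr
    obtain ⟨x, hx, hlead⟩ := exists_lead_le_of_not_gapRule hn I.answer
      fun hs => hr (hrule h hs)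
    rw [hlen] at hlead
    refine le_trans ?_ (Finset.single_le_sum (f := fun x =>
      b * (run I (fun _ => μ) rule t h * w x h)) (fun _ _ => zero_le)
      (Finset.mem_filter.2 ⟨Finset.mem_univ x, hx⟩))
    simp only [mul_left_comm b, hw, hr, if_false]
    gcongr
    rw [hb, ← ENNReal.ofReal_mul (Real.exp_pos _).le, ← Real.exp_add, ENNReal.one_le_ofReal,
      Real.one_le_exp_iff]
    nlinarith [mul_le_mul_of_nonneg_left hlead hμ]
  calc probActive I (fun _ => μ) rule t
      ≤ ∑' h, ∑ x ∈ S, b * (run I (fun _ => μ) rule t h * w x h) := ENNReal.tsum_le_tsum hpt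
    _ = ∑ x ∈ S, b * ∑' h, run I (fun _ => μ) rule t h * w x h := by
        rw [Summable.tsum_finsetSum fun _ _ => ENNReal.summable]
        simp only [ENNReal.tsum_mul_left]
    _ ≤ ∑ x ∈ S, b * ENNReal.ofReal (Real.exp (-(g ^ 2 / 4))) ^ t := by
        refine Finset.sum_le_sum fun x hx => ?_
        gcongr
        exact tsum_run_active_exp_lead_le I rule μ hn hμ (Finset.mem_filter.1 hx).2 t
    _ ≤ n * (b * ENNReal.ofReal (Real.exp (-(g ^ 2 / 4))) ^ t) := by
        rw [Finset.sum_const, nsmul_eq_mul]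
        gcongr
        simpa using Finset.card_le_univ S
    _ ≤ _ := by
        rw [hb, ← ENNReal.ofReal_pow (Real.exp_pos _).le,
          ← ENNReal.ofReal_mul (Real.exp_pos _).le, ← ENNReal.ofReal_natCast n,
          ← ENNReal.ofReal_mul (Nat.cast_nonneg n), mul_assoc]
        refine ENNReal.ofReal_le_ofReal (mul_le_mul_of_nonneg_left ?_ (Nat.cast_nonneg n))
        rw [← Real.exp_nat_mul, ← Real.exp_nat_mul, ← Real.exp_add, ← Real.exp_add,
          Real.exp_le_exp]
        have hsq := Real.sq_sqrt (Nat.cast_nonneg (α := ℝ) t)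
        -- Completing the square: gC√t/2 ≤ C²/2 + g²t/8, so half of the decay g²t/4 survives.
        nlinarith [sq_nonneg (g * √(t : ℝ) / 2 - C), hsq]

/-- Geometric series, with exp(-x) ≤ 1/(1 + x). -/
theorem tsum_exp_pow_le {x : ℝ} (hx : 0 < x) :
    ∑' t : ℕ, ENNReal.ofReal (Real.exp (-x) ^ t) ≤ ENNReal.ofReal (1 + 1 / x) := by
  have h0 := (Real.exp_pos (-x)).le
  have h1 : Real.exp (-x) < 1 := by simpa using hx
  rw [← ENNReal.ofReal_tsum_of_nonneg (fun t => pow_nonneg h0 t)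
    (summable_geometric_of_lt_one h0 h1), tsum_geometric_of_lt_one h0 h1]
  refine ENNReal.ofReal_le_ofReal ?_
  have h2 : Real.exp (-x) ≤ (1 + x)⁻¹ := by
    rw [Real.exp_neg]
    exact inv_anti₀ (by linarith) (by linarith [Real.add_one_le_exp x])
  have h3 : 0 < x / (1 + x) := by positivity
  calc (1 - Real.exp (-x))⁻¹ ≤ (x / (1 + x))⁻¹ := by
        refine inv_anti₀ h3 ?_
        have : x / (1 + x) = 1 - (1 + x)⁻¹ := by field_simp; ring
        linarith
    _ = 1 + 1 / x := by field_simp; ring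

theorem expectedCost_const_le_of_gapRule {k n : ℕ} (hn : 2 ≤ n) {C : ℝ} {T : ℕ}
    (I : Instance k n) (μ : PMF (Fin k)) (hμ : 0 < inducedGap I μ) (rule : History k n → Prop)
    (hrule : ∀ h, totalRule (gapRule n C T) h → rule h) (c : ℝ≥0) :
    expectedCost I (fun _ => c) (fun _ => μ) rule ≤
      ENNReal.ofReal (9 * n * Real.exp (C ^ 2 / 2) * c * (inducedGap I μ ^ 2)⁻¹) := by
  have hg1 := inducedGap_le_one hn I μ
  set g := inducedGap I μ
  have hB : 0 ≤ n * Real.exp (C ^ 2 / 2) := by positivity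
  refine (expectedCost_const_le I _ rule c).trans ?_
  calc (c : ℝ≥0∞) * ∑' s, probActive I (fun _ => μ) rule s
      ≤ c * ∑' s : ℕ, ENNReal.ofReal (n * Real.exp (C ^ 2 / 2)) *
          ENNReal.ofReal (Real.exp (-(g ^ 2 / 8)) ^ s) := by
        gcongr with s
        rw [← ENNReal.ofReal_mul hB]
        exact probActive_le hn I μ hμ.le rule hrule s
    _ ≤ c * (ENNReal.ofReal (n * Real.exp (C ^ 2 / 2)) *
          ENNReal.ofReal (1 + 1 / (g ^ 2 / 8))) := by
        rw [ENNReal.tsum_mul_left]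
        gcongr
        exact tsum_exp_pow_le (by positivity)
    _ ≤ _ := by
        rw [← ENNReal.ofReal_coe_nnreal, ← ENNReal.ofReal_mul hB,
          ← ENNReal.ofReal_mul c.coe_nonneg]
        refine ENNReal.ofReal_le_ofReal ?_
        -- As g ≤ 1, the sum 1 + 8/g² is at most 9/g²; hence the 9.
        have h1 : 1 ≤ (g ^ 2)⁻¹ := (one_le_inv₀ (by positivity)).2 (pow_le_one₀ hμ.le hg1)
        have h2 : 1 + 1 / (g ^ 2 / 8) ≤ 9 * (g ^ 2)⁻¹ := by
          rw [one_div_div, div_eq_mul_inv]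
          linarith
        calc _ ≤ (c : ℝ) * (n * Real.exp (C ^ 2 / 2) * (9 * (g ^ 2)⁻¹)) := by gcongr
          _ = _ := by ring

end BanditSurvey

theorem mainTheorem3 (k n : ℕ) (hk : 1 ≤ k) (hn : 2 ≤ n) (C : ℝ) (hC : 0 < C) :
    ∃ K : ℝ, ∀ T : ℕ, 2 ≤ T →
      ∃ A : BanditSurvey.CrowdSelection k n,
        ∀ (c₀ : ℝ≥0) (I : BanditSurvey.Instance k n),
          BanditSurvey.cost I (fun _ => c₀) A (BanditSurvey.gapRule n C T) ≤
            ENNReal.ofReal (K * c₀ *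
              ((BanditSurvey.maxInducedGap I ^ (k + 2))⁻¹ * √(Real.log T))) ∧
          BanditSurvey.expectedCost I (fun _ => c₀) A
              (BanditSurvey.totalRule (BanditSurvey.gapRule n C T)) ≤
            ENNReal.ofReal (K * c₀ *
              ((BanditSurvey.maxInducedGap I ^ (k + 2))⁻¹ * √(Real.log T))) := by
  have : Nonempty (Fin k) := ⟨⟨0, hk⟩⟩
  -- The factor k² pays for replacing g by f*; dividing by √(log 2) lets √(log T) ≥ √(log 2) be
  -- inserted into a bound free of T.
  refine ⟨9 * n * Real.exp (C ^ 2 / 2) * k ^ 2 / √(Real.log 2), fun T hT =>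
    ⟨fun _ => PMF.uniformOfFintype (Fin k), fun c₀ I => ?_⟩⟩
  have hpos := BanditSurvey.inducedGap_uniform_pos hn I
  have hF := BanditSurvey.maxInducedGap_pos hn I
  have hF1 := BanditSurvey.maxInducedGap_le_one hn I
  have hFg := BanditSurvey.maxInducedGap_le_mul_uniform hn I
  have hbound : 9 * n * Real.exp (C ^ 2 / 2) * c₀ *
      (BanditSurvey.inducedGap I (PMF.uniformOfFintype (Fin k)) ^ 2)⁻¹ ≤
      9 * n * Real.exp (C ^ 2 / 2) * k ^ 2 / √(Real.log 2) * c₀ *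
        ((BanditSurvey.maxInducedGap I ^ (k + 2))⁻¹ * √(Real.log T)) := by
    set g := BanditSurvey.inducedGap I (PMF.uniformOfFintype (Fin k))
    set F := BanditSurvey.maxInducedGap I
    have hlog2 : 0 < √(Real.log 2) := Real.sqrt_pos.2 (Real.log_pos one_lt_two)
    have hlog : √(Real.log 2) ≤ √(Real.log T) := Real.sqrt_le_sqrt
      (Real.log_le_log two_pos (by exact_mod_cast hT))
    have hgF : (g ^ 2)⁻¹ ≤ k ^ 2 * (F ^ (k + 2))⁻¹ := by
      have h1 : F ^ (k + 2) ≤ k ^ 2 * g ^ 2 := by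
        rw [← mul_pow]
        exact (pow_le_pow_of_le_one hF.le hF1 (by omega)).trans (pow_le_pow_left₀ hF.le hFg 2)
      rw [← div_eq_mul_inv, le_div_iff₀ (by positivity), inv_mul_le_iff₀ (by positivity)]
      linarith
    calc _ ≤ 9 * n * Real.exp (C ^ 2 / 2) * c₀ * (k ^ 2 * (F ^ (k + 2))⁻¹) := by gcongr
      _ = 9 * n * Real.exp (C ^ 2 / 2) * k ^ 2 / √(Real.log 2) * c₀ *
          ((F ^ (k + 2))⁻¹ * √(Real.log 2)) := by field_simp
      _ ≤ _ := by gcongr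
  have key := fun rule hrule => (BanditSurvey.expectedCost_const_le_of_gapRule (T := T) hn I
    (PMF.uniformOfFintype (Fin k)) hpos rule hrule c₀).trans (ENNReal.ofReal_le_ofReal hbound)
  exact ⟨key _ fun _ h => Or.inl h, key _ fun _ h => h⟩
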